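/- For all real numbers $\epsilon>0$ and $p^*\in[0,1/2]$ there is a constant $c=c(\epsilon,p^*)>0$, depending only on $\epsilon$ and $p^*$, such that the following holds for all $m,n$ and all $B\in\mathbb{F}_2^{m\times n}$. Let $C^\perp=\{\mathbf{z}\in\mathbb{F}_2^m : B^T\mathbf{z}=0\}$ be the binary linear code with parity-check matrix $B^T$, and let $d^\perp$ be its minimum distance (for $C^\perp=\{0\}$, put $d^\perp=0$). Let $|\cdot|$ denote Hamming weight. Suppose that there is a syndrome decoder $\phi:\mathbb{F}_2^n\to\mathbb{F}_2^m$ with $$\Pr_{\mathbf{y}\sim\mathrm{Ber}(p^*)^m}\big[\phi(B^T\mathbf{y})=\mathbf{y}\big]\ \ge\ \tfrac23,$$ where the coordinates of $\mathbf{y}\sim\mathrm{Ber}(p^*)^m$ are independent and equal to $1$ with probability $p^*$ and to $0$ with probability $1-p^*$. Let $\ell\ge 0$ be an integer with $\ell\le(p^*-\epsilon)m$. Then $$\Pr_{|\mathbf{y}|=\ell}\Big[\,\big|\{\mathbf{z}\in C^\perp\setminus\{0\} : |\mathbf{z}-\mathbf{y}|\le\ell\}\big|>0\,\Big]\ \le\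 \sqrt{m}\,\exp(-c\,d^\perp),$$ where $\mathbf{y}$ is uniformly random among the vectors in $\mathbb{F}_2^m$ of weight exactly $\ell$. -/

import Mathlib

namespace BinaryCode

open Matrix

/-- The linear code `C^⊥ = {z ∈ 𝔽₂^m : Bᵀ z = 0}` with parity-check matrix `Bᵀ`. -/
def dualCode {m n : ℕ} (B : Matrix (Fin m) (Fin n) (ZMod 2)) :
    Submodule (ZMod 2) (Fin m → ZMod 2) :=
  LinearMap.ker (Matrix.mulVecLin Bᵀ)

/-- The (minimum) distance of a binary linear code: the least Hamming distance between two distinct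
codewords. For the code `{0}`, which has no two distinct codewords, the value is `0`. -/
noncomputable def minDistance {m : ℕ} (C : Submodule (ZMod 2) (Fin m → ZMod 2)) : ℕ :=
  sInf {d : ℕ | ∃ x ∈ C, ∃ y ∈ C, x ≠ y ∧ hammingDist x y = d}

/-- The probability of the vector `y` under `Ber(p)^m`: the coordinates are independent, each being
`1` with probability `p` and `0` with probability `1 - p`. -/
noncomputable def bernoulliMass {m : ℕ} (p : ℝ) (y : Fin m → ZMod 2) : ℝ :=
  ∏ i, if y i = 1 then p else 1 - p

/-- The probability of the event `E` when `y ∼ Ber(p)^m`. -/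
noncomputable def bernoulliProb {m : ℕ} (p : ℝ) (E : Set (Fin m → ZMod 2)) : ℝ :=
  ∑ y, E.indicator (bernoulliMass p) y

/-- The Hamming shell of all vectors of weight exactly `ℓ`. -/
def shell (m ℓ : ℕ) : Set (Fin m → ZMod 2) := {y | hammingNorm y = ℓ}

/-- The probability of the event `E` for a uniformly random vector of Hamming weight `ℓ`
(meaningful for `ℓ ≤ m`, when the shell is non-empty). -/
noncomputable def shellProb {m : ℕ} (ℓ : ℕ) (E : Set (Fin m → ZMod 2)) : ℝ :=
  ((shell m ℓ ∩ E).ncard : ℝ) / ((shell m ℓ).ncard : ℝ)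

end BinaryCode

namespace BinaryCode

open Finset

/-! For $|y|=\ell$, a codeword $z\ne0$ satisfies $|z-y|\le\ell$ exactly when $y$ contains at least
half of the support of $z$. So the event is `covered C (1/2)`, which is increasing, and the argument
is a sharp-threshold one.

At noise rate $p$ the decoder forces this event to have probability at most 2/3
(`bernoulliProb_covered_half_le`). By Talagrand's convex distance inequality (`exists_dominates`),
covering a fraction $1/2+\delta$ then has probability at most $3\exp(-\delta^2 d^\perp/8)$, since
passing from one event to the other changes a $\delta$-fraction of the support of a codeword.

It remains to bound the shell probability by the Bernoulli probability of this stronger event. By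
local LYM, shell probabilities of increasing events grow with the weight, so the one at $\ell$ is at
most a constant times the probability at a rate $q$ between $p-\epsilon$ and $p$
(`IsIncreasing.shellProb_mul_le`). Sprinkling extra ones to go from $q$ to $p$ raises the covered
fraction from $1/2$ to $1/2+\rho/4$ with probability at least $\rho/2$
(`mul_bernoulliProb_covered_le`). The constant lost on the way is absorbed in $\sqrt m$
(`le_sqrt_mul_exp`). -/

/-- The mass of `y` under the product of the weights `w i`. -/
noncomputable def prodMass {ι α : Type*} [Fintype ι] (w : ι → α → ℝ) (y : ι → α) : ℝ :=
  ∏ i, w i (y i)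

/-! ### Finite product measures and the reverse Markov inequality -/

section ProdMass

variable {ι α : Type*} [Fintype ι]

theorem prodMass_nonneg {w : ι → α → ℝ} (hw : ∀ i a, 0 ≤ w i a) (y : ι → α) :
    0 ≤ prodMass w y :=
  prod_nonneg fun i _ => hw i (y i)

theorem prodMass_cons {n : ℕ} (w : Fin (n + 1) → α → ℝ) (a : α) (y : Fin n → α) :
    prodMass w (Fin.cons a y : Fin (n + 1) → α) = w 0 a * prodMass (fun i => w i.succ) y := by
  simp [prodMass, Fin.prod_univ_succ]

variable [DecidableEq ι] [Fintype α]

theorem sum_prodMass_eq_prod (w : ι → α → ℝ) :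
    ∑ y, prodMass w y = ∏ i, ∑ a, w i a := by
  classical
  rw [Finset.prod_univ_sum, Fintype.piFinset_univ]
  rfl

theorem sum_prodMass {w : ι → α → ℝ} (hw : ∀ i, ∑ a, w i a = 1) :
    ∑ y, prodMass w y = 1 := by
  rw [sum_prodMass_eq_prod]
  exact prod_eq_one fun i _ => hw i

theorem sum_prodMass_mul_apply {w : ι → α → ℝ} (hw : ∀ i, ∑ a, w i a = 1) (j : ι) (g : α → ℝ) :
    ∑ y, prodMass w y * g (y j) = ∑ a, w j a * g a := by
  have h : ∀ y : ι → α, prodMass w y * g (y j)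
      = prodMass (fun i a => w i a * if i = j then g a else 1) y := by
    intro y
    simp only [prodMass, prod_mul_distrib]
    simp
  simp_rw [h]
  rw [sum_prodMass_eq_prod, prod_eq_single j]
  · simp
  · intro i _ hij
    simp [hij, hw]
  · simp

/-- The reverse Markov inequality for the number of indices `i ∈ s` at which a random vector with
independent coordinates takes a value in `T`. -/
theorem reverse_markov {w : ι → α → ℝ} (hw0 : ∀ i a, 0 ≤ w i a) (hw : ∀ i, ∑ a, w i a = 1)
    (s : Finset ι) (T : α → Prop) [DecidablePred T] {ρ t : ℝ}
    (hρ : ∀ i ∈ s, ρ ≤ ∑ a, if T a then w i a else 0) (hρ1 : ρ ≤ 1) (ht : 0 ≤ t) :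
    ρ - t ≤ ∑ y with t * #s ≤ #{i ∈ s | T (y i)}, prodMass w y := by
  rcases s.eq_empty_or_nonempty with rfl | hs
  · simp only [card_empty, Nat.cast_zero, mul_zero, filter_empty, le_refl, filter_true,
      sum_prodMass hw]
    linarith
  have hcard : (0 : ℝ) < #s := by exact_mod_cast hs.card_pos
  have hE : ∑ y, prodMass w y * (#{i ∈ s | T (y i)} : ℝ)
      = ∑ i ∈ s, ∑ a, if T a then w i a else 0 := by
    have h : ∀ y : ι → α, prodMass w y * (#{i ∈ s | T (y i)} : ℝ)
        = ∑ i ∈ s, prodMass w y * (fun a => if T a then (1 : ℝ) else 0) (y i) := by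
      intro y
      rw [← mul_sum, card_filter]
      push_cast
      rfl
    simp_rw [h]
    rw [sum_comm]
    refine sum_congr rfl fun i _ => ?_
    rw [sum_prodMass_mul_apply hw i (fun a => if T a then (1 : ℝ) else 0)]
    simp
  have h1 : ρ * #s ≤ ∑ y, prodMass w y * (#{i ∈ s | T (y i)} : ℝ) := by
    rw [hE, mul_comm, ← nsmul_eq_mul]
    exact card_nsmul_le_sum _ _ _ hρ
  -- With $X$ the count, $X\le t|s|+|s|\cdot 1_{X\ge t|s|}$ pointwise; taking expectations and
  -- dividing by $|s|$ gives the claim.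
  have h2 : ∀ y, prodMass w y * (#{i ∈ s | T (y i)} : ℝ) ≤
      prodMass w y * (t * #s) +
        (if t * #s ≤ (#{i ∈ s | T (y i)} : ℝ) then prodMass w y else 0) * #s := by
    intro y
    have hy := prodMass_nonneg hw0 y
    have hle : (#{i ∈ s | T (y i)} : ℝ) ≤ #s := by exact_mod_cast card_filter_le _ _
    split_ifs with h
    · have := mul_le_mul_of_nonneg_left hle hy
      have : 0 ≤ prodMass w y * (t * #s) := by positivity
      linarith
    · have := mul_le_mul_of_nonneg_left (not_le.1 h).le hy
      linarith
  have h3 := h1.trans (sum_le_sum fun y _ => h2 y)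
  rw [sum_add_distrib, ← sum_mul, ← sum_mul, sum_prodMass hw, one_mul, ← add_mul] at h3
  rw [sum_filter]
  have := le_of_mul_le_mul_right h3 hcard
  linarith

theorem sum_fin_succ {n : ℕ} (F : (Fin (n + 1) → α) → ℝ) :
    ∑ y, F y = ∑ a, ∑ y : Fin n → α, F (Fin.cons a y) := by
  rw [← (Fin.consEquiv fun _ => α).sum_comp, Fintype.sum_prod_type]
  rfl

end ProdMass

/-! ### Talagrand's convex distance inequality -/

section ConvexDistance

variable {α : Type*}

/-- The vector `v` dominates a convex combination of the disagreement indicators between `x` and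
the points of `A`. This is expressed in dual form, through all non-negative weights. -/
def Dominates {n : ℕ} [DecidableEq α] (A : Finset (Fin n → α)) (x : Fin n → α) (v : Fin n → ℝ) :
    Prop :=
  ∀ a : Fin n → ℝ, (∀ i, 0 ≤ a i) →
    ∃ y ∈ A, ∑ i, (if x i = y i then 0 else a i) ≤ ∑ i, a i * v i

/-- The scalar inequality behind the induction. With constant 1/8 in place of Talagrand's 1/4 there
is room for the rational choice $\theta=\max(0,2r-1)$. -/
theorem exists_interpolation {r : ℝ} (hr0 : 0 < r) (hr1 : r ≤ 1) :
    ∃ θ : ℝ, 0 ≤ θ ∧ θ ≤ 1 ∧ (1 - θ) ^ 2 / 8 - θ * Real.log r ≤ Real.log (2 - r) := by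
  have hlog : 2 * (1 - r) / (1 - r + 2) ≤ Real.log (2 - r) := by
    have := Real.le_log_one_add_of_nonneg (x := 1 - r) (by linarith)
    rwa [show 1 + (1 - r) = 2 - r by ring] at this
  rw [div_le_iff₀ (by linarith)] at hlog
  rcases le_total r (1 / 2) with h | h
  · refine ⟨0, le_rfl, zero_le_one, ?_⟩
    nlinarith
  · refine ⟨2 * r - 1, by linarith, by linarith, ?_⟩
    have h1 : -Real.log r ≤ r⁻¹ - 1 := by
      have := Real.log_le_sub_one_of_pos (inv_pos.2 hr0)
      rwa [Real.log_inv] at this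
    have h2 : (2 * r - 1) * -Real.log r ≤ (2 * r - 1) * (r⁻¹ - 1) :=
      mul_le_mul_of_nonneg_left h1 (by linarith)
    have h3 : (2 * r - 1) * (r⁻¹ - 1) ≤ (1 - r) - (1 - r) ^ 2 := by
      have : (1 - r) - (1 - r) ^ 2 - (2 * r - 1) * (r⁻¹ - 1) = (1 - r) ^ 3 / r := by
        field_simp
        ring
      have : 0 ≤ (1 - r) ^ 3 / r := by
        have : 0 ≤ 1 - r := by linarith
        positivity
      linarith
    have h4 : (1 - r) - (1 - r) ^ 2 / 2 ≤ Real.log (2 - r) := by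
      nlinarith [pow_nonneg (sub_nonneg.2 hr1) 3]
    nlinarith

/-- Plays the role of Hölder's inequality: convexity of exp, applied after $P$ and $Q$ are moved
into the exponents as logarithms, bounds the mixed exponential by a mixture of the two hypotheses.
-/
theorem sum_mul_exp_mix_le {β : Type*} [Fintype β] {m f g : β → ℝ} (hm : ∀ x, 0 ≤ m x)
    {P Q θ : ℝ} (hP : 0 < P) (hQ : 0 < Q) (hPQ : P ≤ Q) (hθ0 : 0 ≤ θ) (hθ1 : θ ≤ 1)
    (hθ : (1 - θ) ^ 2 / 8 - θ * Real.log (P / Q) ≤ Real.log (2 - P / Q))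
    (hf : P * ∑ x, m x * Real.exp (f x) ≤ 1) (hg : Q * ∑ x, m x * Real.exp (g x) ≤ 1) :
    Q * ∑ x, m x * Real.exp ((1 - θ) ^ 2 / 8 + (θ * f x + (1 - θ) * g x)) ≤ 2 - P / Q := by
  have hr : P / Q ≤ 1 := (div_le_one hQ).2 hPQ
  have key : ∀ x, Q * (m x * Real.exp ((1 - θ) ^ 2 / 8 + (θ * f x + (1 - θ) * g x))) ≤
      (2 - P / Q) * (θ * (P * (m x * Real.exp (f x))) + (1 - θ) * (Q * (m x * Real.exp (g x)))) := by
    intro x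
    have hconv := convexOn_exp.2 (Set.mem_univ (f x + Real.log P)) (Set.mem_univ (g x + Real.log Q))
      hθ0 (sub_nonneg.2 hθ1) (by ring)
    simp only [smul_eq_mul] at hconv
    rw [Real.exp_add (f x), Real.exp_add (g x), Real.exp_log hP, Real.exp_log hQ] at hconv
    have hexp : Q * Real.exp ((1 - θ) ^ 2 / 8 + (θ * f x + (1 - θ) * g x)) ≤
        (2 - P / Q) * Real.exp (θ * (f x + Real.log P) + (1 - θ) * (g x + Real.log Q)) := by
      have h2 : 0 < 2 - P / Q := by linarith
      nth_rewrite 1 [← Real.exp_log hQ]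
      rw [← Real.exp_log h2, ← Real.exp_add, ← Real.exp_add, Real.exp_le_exp]
      rw [Real.log_div hP.ne' hQ.ne'] at hθ
      linarith
    have h2 : 0 ≤ 2 - P / Q := by linarith
    have := hexp.trans (mul_le_mul_of_nonneg_left hconv h2)
    have := mul_le_mul_of_nonneg_left this (hm x)
    linarith
  rw [mul_sum]
  refine (sum_le_sum fun x _ => key x).trans ?_
  rw [← mul_sum, sum_add_distrib, ← mul_sum, ← mul_sum, ← mul_sum, ← mul_sum]
  have h1 := mul_le_mul_of_nonneg_left hf hθ0
  have h2 := mul_le_mul_of_nonneg_left hg (sub_nonneg.2 hθ1)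
  nlinarith

/-- A point from the fibre over `a` costs nothing in the first coordinate, one from the projection
costs at most `c 0`. The cheaper of the two is at most their average with weights $\theta$ and
$1-\theta$. -/
theorem Dominates.cons_mix {n : ℕ} [DecidableEq α] {A : Finset (Fin (n + 1) → α)}
    {A₁ A₂ : Finset (Fin n → α)} {a : α} {x : Fin n → α} {v u : Fin n → ℝ} {θ : ℝ}
    (h₁ : ∀ y ∈ A₁, (Fin.cons a y : Fin (n + 1) → α) ∈ A)
    (h₂ : ∀ y ∈ A₂, ∃ b, (Fin.cons b y : Fin (n + 1) → α) ∈ A)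
    (hv : Dominates A₁ x v) (hu : Dominates A₂ x u) (hθ0 : 0 ≤ θ) (hθ1 : θ ≤ 1) :
    Dominates A (Fin.cons a x) (Fin.cons (1 - θ) (θ • v + (1 - θ) • u)) := by
  intro c hc
  obtain ⟨y₁, hy₁, hle₁⟩ := hv (fun i => c i.succ) fun i => hc _
  obtain ⟨y₂, hy₂, hle₂⟩ := hu (fun i => c i.succ) fun i => hc _
  obtain ⟨b, hb⟩ := h₂ y₂ hy₂
  have hsum : ∑ i, c i * (Fin.cons (1 - θ) (θ • v + (1 - θ) • u) : Fin (n + 1) → ℝ) i =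
      θ * ∑ i : Fin n, c i.succ * v i + (1 - θ) * (c 0 + ∑ i : Fin n, c i.succ * u i) := by
    rw [Fin.sum_univ_succ, mul_add, mul_sum, mul_sum]
    simp only [Fin.cons_zero, Fin.cons_succ, Pi.add_apply, Pi.smul_apply, smul_eq_mul, mul_add,
      sum_add_distrib]
    simp only [mul_left_comm, mul_comm (c 0)]
    ring
  rw [hsum]
  rcases le_total (∑ i : Fin n, c i.succ * v i) (c 0 + ∑ i : Fin n, c i.succ * u i) with h | h
  · refine ⟨_, h₁ y₁ hy₁, ?_⟩
    rw [Fin.sum_univ_succ]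
    simp only [Fin.cons_zero, Fin.cons_succ, if_true, zero_add]
    nlinarith
  · refine ⟨_, hb, ?_⟩
    rw [Fin.sum_univ_succ]
    simp only [Fin.cons_zero, Fin.cons_succ]
    have : (if a = b then 0 else c 0) ≤ c 0 := by
      split_ifs
      exacts [hc 0, le_rfl]
    nlinarith

theorem Dominates.cons_one {n : ℕ} [DecidableEq α] {A : Finset (Fin (n + 1) → α)}
    {A₂ : Finset (Fin n → α)} {a : α} {x : Fin n → α} {u : Fin n → ℝ}
    (h₂ : ∀ y ∈ A₂, ∃ b, (Fin.cons b y : Fin (n + 1) → α) ∈ A) (hu : Dominates A₂ x u) :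
    Dominates A (Fin.cons a x) (Fin.cons 1 u) := by
  intro c hc
  obtain ⟨y₂, hy₂, hle₂⟩ := hu (fun i => c i.succ) fun i => hc _
  obtain ⟨b, hb⟩ := h₂ y₂ hy₂
  refine ⟨_, hb, ?_⟩
  rw [Fin.sum_univ_succ, Fin.sum_univ_succ]
  simp only [Fin.cons_zero, Fin.cons_succ, mul_one]
  refine add_le_add ?_ hle₂
  split_ifs
  exacts [hc 0, le_rfl]

theorem sum_sq_mix_le {n : ℕ} (v u : Fin n → ℝ) {θ : ℝ} (hθ0 : 0 ≤ θ) (hθ1 : θ ≤ 1) :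
    ∑ i, ((θ • v + (1 - θ) • u) i) ^ 2 ≤ θ * ∑ i, v i ^ 2 + (1 - θ) * ∑ i, u i ^ 2 := by
  rw [mul_sum, mul_sum, ← sum_add_distrib]
  refine sum_le_sum fun i _ => ?_
  simp only [Pi.add_apply, Pi.smul_apply, smul_eq_mul]
  nlinarith [mul_nonneg (mul_nonneg hθ0 (sub_nonneg.2 hθ1)) (sq_nonneg (v i - u i))]

variable [Fintype α] [DecidableEq α]

/-- Talagrand's convex distance inequality on a product of finite probability spaces. -/
theorem exists_dominates : ∀ (n : ℕ) (w : Fin n → α → ℝ), (∀ i a, 0 ≤ w i a) →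
    (∀ i, ∑ a, w i a = 1) → ∀ A : Finset (Fin n → α), A.Nonempty →
    ∃ V : (Fin n → α) → Fin n → ℝ, (∀ x, Dominates A x (V x)) ∧
      (∑ y ∈ A, prodMass w y) * ∑ x, prodMass w x * Real.exp ((∑ i, V x i ^ 2) / 8) ≤ 1 := by
  intro n
  induction n with
  | zero =>
    intro w hw0 hw1 A ⟨y, hy⟩
    refine ⟨fun _ => 0, fun x a _ => ⟨y, hy, by simp⟩, ?_⟩
    have hA : ∑ y ∈ A, prodMass w y ≤ 1 := by
      rw [← sum_prodMass hw1]
      exact sum_le_sum_of_subset_of_nonneg (subset_univ _) fun y _ _ => prodMass_nonneg hw0 y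
    simpa only [Pi.zero_apply, univ_eq_empty, sum_empty, zero_div, Real.exp_zero, mul_one,
      sum_prodMass hw1] using hA
  | succ n ih =>
    intro w hw0 hw1 A hA
    set w' : Fin n → α → ℝ := fun i => w i.succ with hw'
    have hw'0 : ∀ i a, 0 ≤ w' i a := fun i a => hw0 _ _
    have hw'1 : ∀ i, ∑ a, w' i a = 1 := fun i => hw1 _
    set B : Finset (Fin n → α) := A.image Fin.tail with hB
    set S : α → Finset (Fin n → α) := fun a =>
      univ.filter fun y => (Fin.cons a y : Fin (n + 1) → α) ∈ A with hS
    have hSA : ∀ a, ∀ y ∈ S a, (Fin.cons a y : Fin (n + 1) → α) ∈ A := fun a y hy => by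
      simpa [hS] using hy
    have hBA : ∀ y ∈ B, ∃ b, (Fin.cons b y : Fin (n + 1) → α) ∈ A := fun y hy => by
      obtain ⟨z, hz, rfl⟩ := mem_image.1 hy
      exact ⟨z 0, by rwa [Fin.cons_self_tail]⟩
    have hSB : ∀ a, S a ⊆ B := fun a y hy =>
      mem_image.2 ⟨_, hSA a y hy, Fin.tail_cons _ _⟩
    set Q := ∑ y ∈ B, prodMass w' y with hQ
    set P : α → ℝ := fun a => ∑ y ∈ S a, prodMass w' y with hP
    have hPQ : ∀ a, P a ≤ Q := fun a =>
      sum_le_sum_of_subset_of_nonneg (hSB a) fun y _ _ => prodMass_nonneg hw'0 y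
    have hP0 : ∀ a, 0 ≤ P a := fun a => sum_nonneg fun y _ => prodMass_nonneg hw'0 y
    have hPA : ∑ y ∈ A, prodMass w y = ∑ a, w 0 a * P a := by
      have : ∑ y ∈ A, prodMass w y = ∑ y, if y ∈ A then prodMass w y else 0 := by simp
      rw [this, sum_fin_succ]
      refine sum_congr rfl fun a _ => ?_
      simp only [hP, hS, sum_filter, mul_sum, mul_ite, mul_zero, prodMass_cons]
      rfl
    have hQ0 : 0 ≤ Q := sum_nonneg fun y _ => prodMass_nonneg hw'0 y
    -- If the projection is null, so is `A`, and the constant vector 1 dominates trivially.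
    rcases hQ0.eq_or_lt with hQ0 | hQ0
    · obtain ⟨y, hy⟩ := hA
      refine ⟨fun _ _ => 1, fun x a ha => ⟨y, hy, sum_le_sum fun i _ => ?_⟩, ?_⟩
      · split_ifs <;> simp [ha i]
      · have : ∀ a, P a = 0 := fun a => le_antisymm (hQ0 ▸ hPQ a) (hP0 a)
        rw [hPA]
        simp [this]
    obtain ⟨VB, hVB, hEB⟩ := ih w' hw'0 hw'1 B (hA.image _)
    have hfib : ∀ a, ∃ V : (Fin n → α) → Fin (n + 1) → ℝ,
        (∀ x, Dominates A (Fin.cons a x) (V x)) ∧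
        Q * ∑ x, prodMass w' x * Real.exp ((∑ i, V x i ^ 2) / 8) ≤ 2 - P a / Q := by
      intro a
      rcases (hP0 a).eq_or_lt with ha | ha
      -- A null fibre leaves no logarithm to interpolate with: only the projection is used, at the
      -- price of a factor $e^{1/8}\le2$.
      · refine ⟨fun x => Fin.cons 1 (VB x), fun x => (hVB x).cons_one hBA, ?_⟩
        have he : Real.exp (1 / 8) ≤ 2 := by
          have := Real.add_one_le_exp (-(1 / 8) : ℝ)
          rw [Real.exp_neg, ← one_div, le_div_iff₀ (Real.exp_pos _)] at this
          linarith
        have : ∀ x, prodMass w' x *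
            Real.exp ((∑ i, (Fin.cons 1 (VB x) : Fin (n + 1) → ℝ) i ^ 2) / 8) =
            Real.exp (1 / 8) * (prodMass w' x * Real.exp ((∑ i, VB x i ^ 2) / 8)) := by
          intro x
          rw [Fin.sum_univ_succ]
          simp only [Fin.cons_zero, Fin.cons_succ, one_pow, add_div, Real.exp_add]
          ring
        simp_rw [this]
        rw [← mul_sum, ← ha, zero_div, sub_zero]
        have := mul_le_mul_of_nonneg_left hEB (Real.exp_pos (1 / 8)).le
        linarith
      · have hne : (S a).Nonempty := by
          by_contra h
          rw [not_nonempty_iff_eq_empty] at h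
          simp [hP, h] at ha
        obtain ⟨VS, hVS, hES⟩ := ih w' hw'0 hw'1 (S a) hne
        obtain ⟨θ, hθ0, hθ1, hθ⟩ := exists_interpolation (div_pos ha hQ0)
          ((div_le_one hQ0).2 (hPQ a))
        refine ⟨fun x => Fin.cons (1 - θ) (θ • VS x + (1 - θ) • VB x),
          fun x => Dominates.cons_mix (hSA a) hBA (hVS x) (hVB x) hθ0 hθ1, ?_⟩
        refine le_trans (mul_le_mul_of_nonneg_left (sum_le_sum fun x _ =>
          mul_le_mul_of_nonneg_left (Real.exp_le_exp.2 ?_) (prodMass_nonneg hw'0 x)) hQ0.le)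
          (sum_mul_exp_mix_le (prodMass_nonneg hw'0) ha hQ0 (hPQ a) hθ0 hθ1 hθ hES hEB)
        rw [Fin.sum_univ_succ]
        simp only [Fin.cons_zero, Fin.cons_succ]
        have := sum_sq_mix_le (VS x) (VB x) hθ0 hθ1
        linarith
    choose V hV hE using hfib
    refine ⟨fun x => V (x 0) (Fin.tail x), fun x => ?_, ?_⟩
    · have := hV (x 0) (Fin.tail x)
      rwa [Fin.cons_self_tail] at this
    · set p := ∑ y ∈ A, prodMass w y with hp
      have hE' : Q * ∑ x, prodMass w x * Real.exp ((∑ i, V (x 0) (Fin.tail x) i ^ 2) / 8) ≤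
          2 - p / Q := by
        rw [sum_fin_succ]
        simp only [prodMass_cons, Fin.cons_zero, Fin.tail_cons]
        calc _ = ∑ a, w 0 a * (Q * ∑ x, prodMass w' x *
              Real.exp ((∑ i, V a x i ^ 2) / 8)) := by
              rw [mul_sum]
              refine sum_congr rfl fun a _ => ?_
              simp only [mul_sum, mul_assoc, hw', mul_left_comm Q]
          _ ≤ ∑ a, w 0 a * (2 - P a / Q) :=
              sum_le_sum fun a _ => mul_le_mul_of_nonneg_left (hE a) (hw0 0 a)
          _ = 2 - p / Q := by
              simp only [mul_sub, sum_sub_distrib, ← sum_mul, hw1, hPA, sum_div, mul_div_assoc]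
              ring
      have hp0 : 0 ≤ p / Q := div_nonneg (sum_nonneg fun y _ => prodMass_nonneg hw0 y) hQ0.le
      have h := mul_le_mul_of_nonneg_left hE' hp0
      rw [← mul_assoc, div_mul_cancel₀ _ hQ0.ne'] at h
      -- $t(2-t)\le1$ with $t=p/Q$.
      nlinarith [sq_nonneg (p / Q - 1)]

end ConvexDistance

/-! ### Hamming shells and monotonicity by local LYM -/

section Shell

variable {m : ℕ}

/-- The binary vectors correspond to their supports. -/
def supportEquiv (m : ℕ) : (Fin m → ZMod 2) ≃ Finset (Fin m) where
  toFun y := {i | y i ≠ 0}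
  invFun s i := if i ∈ s then 1 else 0
  left_inv y := by
    funext i
    have : ∀ a : ZMod 2, (if a ≠ 0 then (1 : ZMod 2) else 0) = a := by decide
    simpa using this (y i)
  right_inv s := by
    ext i
    simp

theorem card_supportEquiv (y : Fin m → ZMod 2) : #(supportEquiv m y) = hammingNorm y := rfl

theorem mem_supportEquiv {y : Fin m → ZMod 2} {i : Fin m} : i ∈ supportEquiv m y ↔ y i ≠ 0 := by
  simp [supportEquiv]

/-- Events that persist when the support of a vector grows. -/
def IsIncreasing (E : Set (Fin m → ZMod 2)) : Prop :=
  ∀ ⦃y y' : Fin m → ZMod 2⦄, supportEquiv m y ⊆ supportEquiv m y' → y ∈ E → y' ∈ E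

theorem card_map_supportEquiv (p : (Fin m → ZMod 2) → Prop) [DecidablePred p] :
    #{s : Finset (Fin m) | p ((supportEquiv m).symm s)} = #{y | p y} := by
  refine card_equiv (supportEquiv m).symm fun s => ?_
  simp

theorem card_shell (m k : ℕ) : #{y : Fin m → ZMod 2 | hammingNorm y = k} = m.choose k := by
  rw [← card_map_supportEquiv]
  simp only [← card_supportEquiv, Equiv.apply_symm_apply]
  have h : ({s | #s = k} : Finset (Finset (Fin m))) = powersetCard k univ := by
    ext s
    simp [mem_powersetCard]
  rw [h, card_powersetCard, card_univ, Fintype.card_fin]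

open Classical in
theorem shellProb_eq (k : ℕ) (E : Set (Fin m → ZMod 2)) :
    shellProb k E = (#{y | hammingNorm y = k ∧ y ∈ E} : ℝ) / m.choose k := by
  rw [shellProb, ← card_shell, ← Set.ncard_coe_finset, ← Set.ncard_coe_finset]
  congr 3 <;> ext y <;> simp [shell]

open Classical in
theorem card_shell_add_card_compl (k : ℕ) (E : Set (Fin m → ZMod 2)) :
    #{y | hammingNorm y = k ∧ y ∈ E} + #{y | hammingNorm y = k ∧ y ∉ E} = m.choose k := by
  rw [← card_shell, ← filter_filter, ← filter_filter]
  exact card_filter_add_card_filter_not _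

theorem shellProb_le_one (k : ℕ) (E : Set (Fin m → ZMod 2)) : shellProb k E ≤ 1 := by
  classical
  rw [shellProb_eq]
  refine div_le_one_of_le₀ ?_ (Nat.cast_nonneg _)
  have := card_shell_add_card_compl k E
  exact_mod_cast (by omega)

theorem shellProb_nonneg (k : ℕ) (E : Set (Fin m → ZMod 2)) : 0 ≤ shellProb k E :=
  div_nonneg (Nat.cast_nonneg _) (Nat.cast_nonneg _)

/-- The complement of `E` is closed under deleting ones, so its level $k$ contains the shadow of its
level $k+1$; local LYM says that the shadow is at least as dense. -/
theorem IsIncreasing.shellProb_le_succ {E : Set (Fin m → ZMod 2)} (hE : IsIncreasing E) {k : ℕ}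
    (hk : k + 1 ≤ m) : shellProb k E ≤ shellProb (k + 1) E := by
  classical
  set D : ℕ → Finset (Finset (Fin m)) := fun k =>
    {s | hammingNorm ((supportEquiv m).symm s) = k ∧ (supportEquiv m).symm s ∉ E} with hD
  have hnorm : ∀ s, hammingNorm ((supportEquiv m).symm s) = #s := fun s => by
    rw [← card_supportEquiv, Equiv.apply_symm_apply]
  have hcard : ∀ k, (#{y | hammingNorm y = k ∧ y ∈ E} : ℝ) = m.choose k - #(D k) := by
    intro k
    rw [hD, card_map_supportEquiv (fun y => hammingNorm y = k ∧ y ∉ E),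
      ← card_shell_add_card_compl k E]
    push_cast
    ring
  have hsized : Set.Sized (k + 1) (D (k + 1) : Set (Finset (Fin m))) := fun s hs => by
    have : s ∈ D (k + 1) := hs
    rw [← hnorm s]
    exact (mem_filter.1 this).2.1
  have hshadow : (D (k + 1)).shadow ⊆ D k := by
    intro t ht
    obtain ⟨s, hs, a, ha, rfl⟩ := mem_shadow_iff.1 ht
    simp only [hD, mem_filter, mem_univ, true_and, hnorm] at hs ⊢
    refine ⟨by rw [card_erase_of_mem ha]; omega, fun h => hs.2 (hE ?_ h)⟩
    simpa using erase_subset a s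
  have hlym := local_lubell_yamamoto_meshalkin_inequality_div (𝕜 := ℝ) k.succ_ne_zero hsized
  rw [Fintype.card_fin, Nat.succ_eq_add_one, Nat.add_sub_cancel] at hlym
  have h0 : (0 : ℝ) < m.choose k := by exact_mod_cast Nat.choose_pos (by omega)
  have h1 : (0 : ℝ) < m.choose (k + 1) := by exact_mod_cast Nat.choose_pos hk
  have hle : (#((D (k + 1)).shadow) : ℝ) / m.choose k ≤ #(D k) / m.choose k := by
    gcongr
  rw [shellProb_eq, shellProb_eq, hcard, hcard, sub_div, sub_div, div_self h0.ne',
    div_self h1.ne']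
  linarith

theorem IsIncreasing.shellProb_mono {E : Set (Fin m → ZMod 2)} (hE : IsIncreasing E) {k l : ℕ}
    (hkl : k ≤ l) (hl : l ≤ m) : shellProb k E ≤ shellProb l E := by
  induction l, hkl using Nat.le_induction with
  | base => exact le_rfl
  | succ l _ ih => exact (ih (by omega)).trans (hE.shellProb_le_succ hl)

end Shell

/-! ### From shells to Bernoulli noise -/

section Bernoulli

variable {m : ℕ}

/-- The mass function of `Ber(p)` on `𝔽₂`. -/
noncomputable def bern (p : ℝ) (a : ZMod 2) : ℝ := if a = 1 then p else 1 - p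

theorem bernoulliMass_eq_prodMass (p : ℝ) (y : Fin m → ZMod 2) :
    bernoulliMass p y = prodMass (fun _ => bern p) y := rfl

theorem sum_zmod_two (f : ZMod 2 → ℝ) : ∑ a, f a = f 0 + f 1 :=
  Fin.sum_univ_two f

theorem sum_bern (p : ℝ) : ∑ a, bern p a = 1 := by
  rw [sum_zmod_two]
  simp [bern]

theorem bern_nonneg {p : ℝ} (hp0 : 0 ≤ p) (hp1 : p ≤ 1) (a : ZMod 2) : 0 ≤ bern p a := by
  unfold bern
  split_ifs <;> linarith

theorem bernoulliMass_nonneg {p : ℝ} (hp0 : 0 ≤ p) (hp1 : p ≤ 1) (y : Fin m → ZMod 2) :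
    0 ≤ bernoulliMass p y :=
  prodMass_nonneg (fun _ => bern_nonneg hp0 hp1) y

theorem sum_bernoulliMass (p : ℝ) : ∑ y : Fin m → ZMod 2, bernoulliMass p y = 1 :=
  sum_prodMass fun _ => sum_bern p

theorem bernoulliProb_eq (p : ℝ) (E : Set (Fin m → ZMod 2)) [DecidablePred (· ∈ E)] :
    bernoulliProb p E = ∑ y with y ∈ E, bernoulliMass p y := by
  rw [bernoulliProb, sum_filter]
  refine sum_congr rfl fun y _ => ?_
  by_cases h : y ∈ E <;> simp [h]

theorem bernoulliProb_nonneg {p : ℝ} (hp0 : 0 ≤ p) (hp1 : p ≤ 1) (E : Set (Fin m → ZMod 2)) :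
    0 ≤ bernoulliProb p E := by
  classical
  rw [bernoulliProb_eq]
  exact sum_nonneg fun y _ => bernoulliMass_nonneg hp0 hp1 y

theorem bernoulliProb_add_compl (p : ℝ) (E : Set (Fin m → ZMod 2)) :
    bernoulliProb p E + bernoulliProb p Eᶜ = 1 := by
  classical
  rw [bernoulliProb_eq, bernoulliProb_eq, ← sum_bernoulliMass (m := m) p]
  exact sum_filter_add_sum_filter_not _ _ _

theorem bernoulliMass_eq_pow (p : ℝ) (y : Fin m → ZMod 2) :
    bernoulliMass p y = p ^ hammingNorm y * (1 - p) ^ (m - hammingNorm y) := by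
  have h : ∀ a : ZMod 2, a = 1 ↔ a ≠ 0 := by decide
  simp only [bernoulliMass, h]
  rw [prod_ite, prod_const, prod_const]
  congr 2
  have := card_filter_add_card_filter_not (s := (univ : Finset (Fin m))) fun i => y i ≠ 0
  rw [card_univ, Fintype.card_fin] at this
  change _ = m - #{i | y i ≠ 0}
  omega

theorem hammingNorm_le (y : Fin m → ZMod 2) : hammingNorm y ≤ m := by
  simpa using hammingNorm_le_card_fintype (x := y)

theorem bernoulliMass_le_of_hammingNorm_le {p : ℝ} (hp0 : 0 ≤ p) (hp : p ≤ 1 / 2)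
    {y y' : Fin m → ZMod 2} (h : hammingNorm y' ≤ hammingNorm y) :
    bernoulliMass p y ≤ bernoulliMass p y' := by
  rw [bernoulliMass_eq_pow, bernoulliMass_eq_pow]
  have hy := hammingNorm_le y
  obtain ⟨k, hk⟩ := Nat.exists_eq_add_of_le h
  rw [hk, show m - hammingNorm y' = k + (m - (hammingNorm y' + k)) by omega, pow_add, pow_add,
    mul_assoc]
  have h1 : 0 ≤ 1 - p := by linarith
  have : p ≤ 1 - p := by linarith
  gcongr

/-- The weight reaches $\ell$ with probability at least $\eta$, and on each shell of weight
$k\ge\ell$ the event is at least as likely as at $\ell$. -/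
theorem IsIncreasing.shellProb_mul_le {E : Set (Fin m → ZMod 2)} (hE : IsIncreasing E) {q : ℝ}
    (hq0 : 0 ≤ q) (hq1 : q ≤ 1) {ℓ : ℕ} {η : ℝ} (hm : 0 < m) (hℓ : (ℓ : ℝ) ≤ (q - η) * m) :
    η * shellProb ℓ E ≤ bernoulliProb q E := by
  classical
  have hm' : (0 : ℝ) < m := by exact_mod_cast hm
  -- The mean weight is $qm$, so reverse Markov with $t=\ell/m\le q-\eta$ suffices, without any
  -- concentration.
  have htail : η ≤ ∑ y : Fin m → ZMod 2 with ℓ ≤ hammingNorm y, bernoulliMass q y := by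
    have h := reverse_markov (w := fun _ : Fin m => bern q) (fun _ => bern_nonneg hq0 hq1)
      (fun _ => sum_bern q) univ (fun a => a ≠ 0) (ρ := q) (t := ℓ / m)
      (fun i _ => by rw [sum_zmod_two]; simp [bern]) hq1 (by positivity)
    rw [card_univ, Fintype.card_fin, div_mul_cancel₀ _ hm'.ne'] at h
    have h2 : (ℓ : ℝ) / m ≤ q - η := (div_le_iff₀ hm').2 hℓ
    simp only [Nat.cast_le] at h
    exact le_trans (by linarith) h
  have hfib : ∀ F : (Fin m → ZMod 2) → Prop,
      ∑ y : Fin m → ZMod 2 with ℓ ≤ hammingNorm y ∧ F y, bernoulliMass q y =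
      ∑ k ∈ Icc ℓ m, q ^ k * (1 - q) ^ (m - k) * #{y | hammingNorm y = k ∧ F y} := by
    intro F
    rw [← sum_fiberwise_of_maps_to (t := Icc ℓ m) (g := hammingNorm)
      (fun y hy => mem_Icc.2 ⟨(mem_filter.1 hy).2.1, hammingNorm_le y⟩)]
    refine sum_congr rfl fun k hk => ?_
    rw [filter_filter, mul_comm, ← nsmul_eq_mul, ← sum_const]
    refine sum_congr ?_ fun y hy => ?_
    · ext y
      have := (mem_Icc.1 hk).1
      simp only [mem_filter, mem_univ, true_and]
      constructor
      · rintro ⟨⟨_, h⟩, rfl⟩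
        exact ⟨rfl, h⟩
      · rintro ⟨rfl, h⟩
        exact ⟨⟨this, h⟩, rfl⟩
    · rw [bernoulliMass_eq_pow, (mem_filter.1 hy).2.1]
  have hall := hfib fun _ => True
  simp only [and_true] at hall
  calc η * shellProb ℓ E
      ≤ (∑ y : Fin m → ZMod 2 with ℓ ≤ hammingNorm y, bernoulliMass q y) * shellProb ℓ E :=
        mul_le_mul_of_nonneg_right htail (shellProb_nonneg _ _)
    _ ≤ ∑ y : Fin m → ZMod 2 with ℓ ≤ hammingNorm y ∧ y ∈ E, bernoulliMass q y := by
        rw [hall, hfib, sum_mul]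
        refine sum_le_sum fun k hk => ?_
        rw [mul_assoc]
        have : 0 ≤ 1 - q := by linarith
        refine mul_le_mul_of_nonneg_left ?_ (by positivity)
        have hk' := mem_Icc.1 hk
        have hmono := hE.shellProb_mono hk'.1 hk'.2
        rw [shellProb_eq k] at hmono
        have h0 : (0 : ℝ) < m.choose k := by exact_mod_cast Nat.choose_pos hk'.2
        rw [card_shell, mul_comm]
        exact (le_div_iff₀ h0).1 hmono
    _ ≤ bernoulliProb q E := by
        rw [bernoulliProb_eq]
        refine sum_le_sum_of_subset_of_nonneg (fun y hy => ?_)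
          fun y _ _ => bernoulliMass_nonneg hq0 hq1 y
        simp only [mem_filter, mem_univ, true_and] at hy ⊢
        exact hy.2

end Bernoulli

/-! ### Covered vectors: decoding, concentration, sprinkling -/

section Code

variable {m : ℕ}

/-- The number of common ones of two binary vectors. -/
def overlap (z y : Fin m → ZMod 2) : ℕ := #{i | z i ≠ 0 ∧ y i ≠ 0}

theorem hammingDist_add_overlap (z y : Fin m → ZMod 2) :
    hammingDist z y + 2 * overlap z y = hammingNorm z + hammingNorm y := by
  simp only [hammingDist, hammingNorm, overlap, card_filter, mul_sum, ← sum_add_distrib]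
  refine sum_congr rfl fun i _ => ?_
  have h : ∀ a b : ZMod 2, (if a ≠ b then 1 else 0) + 2 * (if a ≠ 0 ∧ b ≠ 0 then 1 else 0) =
      (if a ≠ 0 then 1 else 0) + if b ≠ 0 then 1 else 0 := by decide
  exact h (z i) (y i)

theorem overlap_mono (z : Fin m → ZMod 2) {y y' : Fin m → ZMod 2}
    (h : supportEquiv m y ⊆ supportEquiv m y') : overlap z y ≤ overlap z y' := by
  refine card_le_card fun i hi => ?_
  simp only [mem_filter, mem_univ, true_and] at hi ⊢
  exact ⟨hi.1, mem_supportEquiv.1 (h (mem_supportEquiv.2 hi.2))⟩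

/-- The vectors that some nonzero codeword covers in at least a fraction `β` of its support. -/
def covered (C : Submodule (ZMod 2) (Fin m → ZMod 2)) (β : ℝ) : Set (Fin m → ZMod 2) :=
  {y | ∃ z ∈ C, z ≠ 0 ∧ β * hammingNorm z ≤ overlap z y}

theorem isIncreasing_covered (C : Submodule (ZMod 2) (Fin m → ZMod 2)) (β : ℝ) :
    IsIncreasing (covered C β) := by
  rintro y y' h ⟨z, hz, hz0, hle⟩
  exact ⟨z, hz, hz0, hle.trans (by exact_mod_cast overlap_mono z h)⟩

theorem half_mul_le_overlap_iff (z y : Fin m → ZMod 2) :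
    (1 / 2 : ℝ) * hammingNorm z ≤ overlap z y ↔ hammingDist z y ≤ hammingNorm y := by
  have h := hammingDist_add_overlap z y
  have h2 : (1 / 2 : ℝ) * hammingNorm z ≤ overlap z y ↔ hammingNorm z ≤ 2 * overlap z y := by
    rw [← Nat.cast_le (α := ℝ)]
    push_cast
    constructor <;> intro h <;> linarith
  rw [h2]
  omega

theorem minDistance_le {C : Submodule (ZMod 2) (Fin m → ZMod 2)} {z : Fin m → ZMod 2}
    (hz : z ∈ C) (hz0 : z ≠ 0) : minDistance C ≤ hammingNorm z :=
  Nat.sInf_le ⟨z, hz, 0, C.zero_mem, hz0, hammingDist_zero_right z⟩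

/-- Every covered `y` has a competitor $y+z(y)$ with the same syndrome and no larger weight, hence
at least as likely because $p\le1/2$. If `y` is decoded correctly, its competitor is not, so the
covered vectors decoded correctly weigh no more than the decoding errors; the total is at most
$2\cdot\frac13$. -/
theorem bernoulliProb_covered_half_le {n : ℕ} {p : ℝ} (hp0 : 0 ≤ p) (hp : p ≤ 1 / 2)
    (B : Matrix (Fin m) (Fin n) (ZMod 2)) (φ : (Fin n → ZMod 2) → (Fin m → ZMod 2))
    (hφ : 2 / 3 ≤ bernoulliProb p {y : Fin m → ZMod 2 | φ (B.transpose.mulVec y) = y}) :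
    bernoulliProb p (covered (dualCode B) (1 / 2)) ≤ 2 / 3 := by
  classical
  set S : Set (Fin m → ZMod 2) := {y | φ (B.transpose.mulVec y) = y} with hS
  set U := covered (dualCode B) (1 / 2) with hU
  have hz : ∀ y, ∃ z, y ∈ U → (B.transpose.mulVec z = 0 ∧ z ≠ 0 ∧
      hammingNorm (y + z) ≤ hammingNorm y) := by
    intro y
    by_cases hy : y ∈ U
    · obtain ⟨z, hzC, hz0, hle⟩ := hy
      refine ⟨z, fun _ => ⟨by simpa only [dualCode, LinearMap.mem_ker, Matrix.mulVecLin_apply] using hzC, hz0, ?_⟩⟩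
      rw [half_mul_le_overlap_iff, hammingDist_comm, hammingDist_eq_hammingNorm] at hle
      rwa [show -y = y from funext fun i => ZMod.neg_eq_self_mod_two (y i)] at hle
    · exact ⟨0, fun h => absurd h hy⟩
  choose z hz using hz
  have hsum := bernoulliProb_add_compl p S
  have hUS : ∑ y with y ∈ U ∧ y ∈ S, bernoulliMass p y ≤ bernoulliProb p Sᶜ := by
    calc ∑ y with y ∈ U ∧ y ∈ S, bernoulliMass p y
        ≤ ∑ y with y ∈ U ∧ y ∈ S, bernoulliMass p (y + z y) :=
          sum_le_sum fun y hy => bernoulliMass_le_of_hammingNorm_le hp0 hp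
            (hz y (mem_filter.1 hy).2.1).2.2
      _ = ∑ x ∈ image (fun y => y + z y) {y | y ∈ U ∧ y ∈ S}, bernoulliMass p x := by
          -- Injectivity: $y+z(y)$ determines the syndrome of `y`, from which `φ` recovers `y`.
          rw [sum_image]
          intro y hy y' hy' h
          have hy := (mem_filter.1 (mem_coe.1 hy)).2
          have hy' := (mem_filter.1 (mem_coe.1 hy')).2
          have h2 := congrArg B.transpose.mulVec h
          simp only [Matrix.mulVec_add, (hz y hy.1).1, (hz y' hy'.1).1, add_zero] at h2
          rw [← show φ (B.transpose.mulVec y) = y from hy.2, h2]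
          exact hy'.2
      _ ≤ bernoulliProb p Sᶜ := by
          rw [bernoulliProb_eq]
          refine sum_le_sum_of_subset_of_nonneg (fun x hx => ?_)
            fun y _ _ => bernoulliMass_nonneg hp0 (by linarith) y
          obtain ⟨y, hy, rfl⟩ := mem_image.1 hx
          have hy := (mem_filter.1 hy).2
          refine mem_filter.2 ⟨mem_univ _, fun h => (hz y hy.1).2.1 ?_⟩
          have h : φ (B.transpose.mulVec (y + z y)) = y + z y := h
          rw [Matrix.mulVec_add, (hz y hy.1).1, add_zero,
            show φ (B.transpose.mulVec y) = y from hy.2] at h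
          simpa using h
  have hUSc : ∑ y with y ∈ U ∧ y ∉ S, bernoulliMass p y ≤ bernoulliProb p Sᶜ := by
    rw [bernoulliProb_eq]
    refine sum_le_sum_of_subset_of_nonneg (fun y hy => ?_)
      fun y _ _ => bernoulliMass_nonneg hp0 (by linarith) y
    simp only [mem_filter, mem_univ, true_and] at hy ⊢
    exact hy.2
  have hsplit : bernoulliProb p U = ∑ y with y ∈ U ∧ y ∈ S, bernoulliMass p y +
      ∑ y with y ∈ U ∧ y ∉ S, bernoulliMass p y := by
    rw [bernoulliProb_eq, ← filter_filter, ← filter_filter]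
    exact (sum_filter_add_sum_filter_not _ _ _).symm
  linarith

/-- Test domination with the indicator of the support of the codeword `z` covering `x`. Any `y` in
`A` misses more than $\delta|z|$ of the ones that `x` has there, so `v` sums to at least $\delta|z|$
on that support; Cauchy–Schwarz and $|z|\ge d$ finish. -/
theorem mul_minDistance_le_sum_sq {C : Submodule (ZMod 2) (Fin m → ZMod 2)} {δ : ℝ} (hδ : 0 ≤ δ)
    {A : Finset (Fin m → ZMod 2)} (hA : ∀ y ∈ A, y ∉ covered C (1 / 2)) {x : Fin m → ZMod 2}
    (hx : x ∈ covered C (1 / 2 + δ)) {v : Fin m → ℝ} (hv : Dominates A x v) :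
    δ ^ 2 * minDistance C ≤ ∑ i, v i ^ 2 := by
  obtain ⟨z, hz, hz0, hle⟩ := hx
  obtain ⟨y, hy, hxy⟩ := hv (fun i => if z i ≠ 0 then 1 else 0) fun i => by split_ifs <;> norm_num
  have hy' : (overlap z y : ℝ) < 1 / 2 * hammingNorm z := by
    by_contra h
    exact hA y hy ⟨z, hz, hz0, not_lt.1 h⟩
  have hdiff : (overlap z x : ℝ) - overlap z y ≤
      ∑ i, (if x i = y i then 0 else if z i ≠ 0 then (1 : ℝ) else 0) := by
    simp only [overlap, card_filter]
    push_cast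
    rw [← sum_sub_distrib]
    refine sum_le_sum fun i _ => ?_
    by_cases h1 : z i = 0 <;> by_cases h2 : x i = y i <;> simp [h1, h2]
    split_ifs <;> norm_num
  set N : ℝ := (hammingNorm z : ℝ) with hN
  have hNpos : 0 < N := Nat.cast_pos.2 (hammingNorm_pos_iff.2 hz0)
  have hlin : δ * N ≤ ∑ i with z i ≠ 0, v i := by
    rw [sum_filter]
    simp only [ite_mul, one_mul, zero_mul] at hxy
    linarith
  have hcs : (∑ i with z i ≠ 0, v i) ^ 2 ≤ N * ∑ i with z i ≠ 0, v i ^ 2 :=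
    sq_sum_le_card_mul_sum_sq
  have hsub : ∑ i with z i ≠ 0, v i ^ 2 ≤ ∑ i, v i ^ 2 :=
    sum_le_sum_of_subset_of_nonneg (filter_subset _ _) fun i _ _ => sq_nonneg _
  have hd : (minDistance C : ℝ) ≤ N := Nat.cast_le.2 (minDistance_le hz hz0)
  have h1 : (δ * N) ^ 2 ≤ (∑ i with z i ≠ 0, v i) ^ 2 := by gcongr
  have h2 : N * (δ ^ 2 * N) ≤ N * ∑ i with z i ≠ 0, v i ^ 2 := by linarith
  have h3 := le_of_mul_le_mul_left h2 hNpos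
  have h4 : δ ^ 2 * minDistance C ≤ δ ^ 2 * N := by gcongr
  linarith

theorem bernoulliProb_compl_mul_covered_le {p : ℝ} (hp0 : 0 ≤ p) (hp1 : p ≤ 1)
    (C : Submodule (ZMod 2) (Fin m → ZMod 2)) {δ : ℝ} (hδ : 0 ≤ δ) :
    bernoulliProb p (covered C (1 / 2))ᶜ * (bernoulliProb p (covered C (1 / 2 + δ)) *
      Real.exp (δ ^ 2 * minDistance C / 8)) ≤ 1 := by
  classical
  set A : Finset (Fin m → ZMod 2) := {y | y ∈ (covered C (1 / 2))ᶜ} with hA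
  have hPA : bernoulliProb p (covered C (1 / 2))ᶜ = ∑ y ∈ A, bernoulliMass p y :=
    bernoulliProb_eq _ _
  rcases A.eq_empty_or_nonempty with h | h
  · rw [hPA, h]
    simp
  obtain ⟨V, hV, hle⟩ := exists_dominates m (fun _ => bern p) (fun _ => bern_nonneg hp0 hp1)
    (fun _ => sum_bern p) A h
  refine le_trans (mul_le_mul_of_nonneg_left ?_ (bernoulliProb_nonneg hp0 hp1 _)) (hPA ▸ hle)
  rw [bernoulliProb_eq, sum_mul]
  calc _ ≤ ∑ x with x ∈ covered C (1 / 2 + δ),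
        bernoulliMass p x * Real.exp ((∑ i, V x i ^ 2) / 8) := by
        refine sum_le_sum fun x hx => mul_le_mul_of_nonneg_left (Real.exp_le_exp.2 ?_)
          (bernoulliMass_nonneg hp0 hp1 x)
        have := mul_minDistance_le_sum_sq hδ (A := A) (fun y hy => by simpa [hA] using hy)
          (mem_filter.1 hx).2 (hV x)
        linarith
    _ ≤ _ := sum_le_sum_of_subset_of_nonneg (filter_subset _ _) fun x _ _ =>
        mul_nonneg (bernoulliMass_nonneg hp0 hp1 x) (Real.exp_pos _).le

/-- The law of a vector obtained from `y` by turning each zero into a one with probability `ρ`. -/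
noncomputable def raise (ρ : ℝ) (y : Fin m → ZMod 2) (i : Fin m) (a : ZMod 2) : ℝ :=
  if y i = 1 then (if a = 1 then 1 else 0) else bern ρ a

theorem raise_nonneg {ρ : ℝ} (hρ0 : 0 ≤ ρ) (hρ1 : ρ ≤ 1) (y : Fin m → ZMod 2) (i : Fin m)
    (a : ZMod 2) : 0 ≤ raise ρ y i a := by
  have := bern_nonneg hρ0 hρ1 a
  unfold raise
  split_ifs <;> first | assumption | norm_num

theorem sum_raise (ρ : ℝ) (y : Fin m → ZMod 2) (i : Fin m) : ∑ a, raise ρ y i a = 1 := by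
  unfold raise
  split_ifs
  · simp
  · exact sum_bern ρ

/-- The sprinkling coupling, checked coordinate by coordinate. -/
theorem sum_bernoulliMass_mul_raise (q ρ : ℝ) (x : Fin m → ZMod 2) :
    ∑ y, bernoulliMass q y * prodMass (raise ρ y) x = bernoulliMass (q + (1 - q) * ρ) x := by
  have h : ∀ y : Fin m → ZMod 2, bernoulliMass q y * prodMass (raise ρ y) x =
      prodMass (fun i a => bern q a * if a = 1 then (if x i = 1 then 1 else 0) else bern ρ (x i))
        y := by
    intro y
    rw [bernoulliMass_eq_prodMass, prodMass, prodMass, prodMass, ← prod_mul_distrib]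
    rfl
  simp_rw [h]
  rw [sum_prodMass_eq_prod]
  refine prod_congr rfl fun i _ => ?_
  rw [sum_zmod_two]
  simp only [bern]
  split_ifs <;> simp_all <;> ring

/-- Reverse Markov on the zeros of `y` inside the support of `z`: with probability at least
$\rho/2$, a fraction $\rho/2$ of them turns into ones. An overlap $o\ge|z|/2$ then becomes at least
$o+\frac{\rho}{2}(|z|-o)\ge(\frac12+\frac{\rho}{4})|z|$. -/
theorem half_le_raise_covered {ρ : ℝ} (hρ0 : 0 ≤ ρ) (hρ1 : ρ ≤ 1)
    {C : Submodule (ZMod 2) (Fin m → ZMod 2)} {y : Fin m → ZMod 2} (hy : y ∈ covered C (1 / 2))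
    [DecidablePred (· ∈ covered C (1 / 2 + ρ / 4))] :
    ρ / 2 ≤ ∑ x with x ∈ covered C (1 / 2 + ρ / 4), prodMass (raise ρ y) x := by
  obtain ⟨z, hz, hz0, hle⟩ := hy
  have h := reverse_markov (raise_nonneg hρ0 hρ1 y) (sum_raise ρ y) {i | z i ≠ 0 ∧ y i = 0}
    (fun a => a ≠ 0) (ρ := ρ) (t := ρ / 2) (fun i hi => by
      rw [sum_zmod_two]
      simp [raise, bern, (mem_filter.1 hi).2.2]) hρ1 (by linarith)
  refine le_trans (by linarith) (h.trans ?_)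
  rw [sum_filter, sum_filter]
  refine sum_le_sum fun x _ => ?_
  by_cases hx : prodMass (raise ρ y) x = 0
  · simp [hx]
  by_cases hc : ρ / 2 * (#{i | z i ≠ 0 ∧ y i = 0} : ℝ) ≤
      #{i ∈ ({i | z i ≠ 0 ∧ y i = 0} : Finset (Fin m)) | x i ≠ 0}
  swap
  · rw [if_neg hc]
    split_ifs
    exacts [prodMass_nonneg (raise_nonneg hρ0 hρ1 y) x, le_rfl]
  -- Sprinkling never erases a one, so an `x` of nonzero mass contains the support of `y`.
  have hyx : ∀ i, y i ≠ 0 → x i ≠ 0 := by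
    intro i hi hxi
    refine hx (prod_eq_zero (mem_univ i) ?_)
    have : ∀ a : ZMod 2, a ≠ 0 → a = 1 := by decide
    simp [raise, this _ hi, hxi]
  have hx : (overlap z x : ℝ) = overlap z y +
      #{i ∈ ({i | z i ≠ 0 ∧ y i = 0} : Finset (Fin m)) | x i ≠ 0} := by
    rw [filter_filter]
    simp only [overlap, card_filter]
    push_cast
    rw [← sum_add_distrib]
    refine sum_congr rfl fun i _ => ?_
    have := hyx i
    by_cases h1 : z i = 0 <;> by_cases h2 : y i = 0 <;> simp_all
  have hN : (hammingNorm z : ℝ) = overlap z y + #{i | z i ≠ 0 ∧ y i = 0} := by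
    simp only [overlap, hammingNorm, card_filter]
    push_cast
    rw [← sum_add_distrib]
    refine sum_congr rfl fun i _ => ?_
    by_cases h1 : z i = 0 <;> by_cases h2 : y i = 0 <;> simp_all
  have hmem : x ∈ covered C (1 / 2 + ρ / 4) := by
    refine ⟨z, hz, hz0, ?_⟩
    nlinarith
  rw [if_pos hc, if_pos hmem]

theorem mul_bernoulliProb_covered_le {q ρ : ℝ} (hq0 : 0 ≤ q) (hq1 : q ≤ 1) (hρ0 : 0 ≤ ρ)
    (hρ1 : ρ ≤ 1) (C : Submodule (ZMod 2) (Fin m → ZMod 2)) :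
    ρ / 2 * bernoulliProb q (covered C (1 / 2)) ≤
      bernoulliProb (q + (1 - q) * ρ) (covered C (1 / 2 + ρ / 4)) := by
  classical
  rw [bernoulliProb_eq, bernoulliProb_eq, mul_sum]
  simp only [← sum_bernoulliMass_mul_raise]
  rw [sum_comm, sum_filter]
  refine sum_le_sum fun y _ => ?_
  rw [← mul_sum]
  split_ifs with hy
  · rw [mul_comm]
    exact mul_le_mul_of_nonneg_left (half_le_raise_covered hρ0 hρ1 hy)
      (bernoulliMass_nonneg hq0 hq1 y)
  · exact mul_nonneg (bernoulliMass_nonneg hq0 hq1 y)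
      (sum_nonneg fun x _ => prodMass_nonneg (raise_nonneg hρ0 hρ1 y) x)

end Code
-- Assembling the bound
theorem shellProb_confusable_eq {m : ℕ} (C : Submodule (ZMod 2) (Fin m → ZMod 2)) (ℓ : ℕ) :
    shellProb ℓ {y : Fin m → ZMod 2 |
        0 < {z : Fin m → ZMod 2 | z ∈ C ∧ z ≠ 0 ∧ hammingDist z y ≤ ℓ}.ncard} =
      shellProb ℓ (covered C (1 / 2)) := by
  unfold shellProb
  congr 3
  ext y
  refine and_congr_right fun hy => ?_
  have hy : hammingNorm y = ℓ := hy
  refine (Set.ncard_pos (Set.toFinite _)).trans (exists_congr fun z => ?_)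
  rw [half_mul_le_overlap_iff, hy]
  rfl

theorem shellProb_zero_covered {m : ℕ} (C : Submodule (ZMod 2) (Fin m → ZMod 2)) :
    shellProb 0 (covered C (1 / 2)) = 0 := by
  have : shell m 0 ∩ covered C (1 / 2) = ∅ := by
    rw [Set.eq_empty_iff_forall_notMem]
    rintro y ⟨hy, z, -, hz0, hle⟩
    rw [half_mul_le_overlap_iff, show hammingNorm y = 0 from hy, hammingNorm_eq_zero.1 hy,
      hammingDist_zero_right, Nat.le_zero, hammingNorm_eq_zero] at hle
    exact hz0 hle
  rw [shellProb, this]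
  simp

theorem shellProb_covered_le {m n : ℕ} {ε p : ℝ} (hε : 0 < ε) (hp : p ≤ 1 / 2)
    (B : Matrix (Fin m) (Fin n) (ZMod 2)) (φ : (Fin n → ZMod 2) → (Fin m → ZMod 2)) {ℓ : ℕ}
    (hφ : 2 / 3 ≤ bernoulliProb p {y : Fin m → ZMod 2 | φ (B.transpose.mulVec y) = y})
    (hm : 0 < m) (hℓ : (ℓ : ℝ) ≤ (p - ε) * m) :
    shellProb ℓ (covered (dualCode B) (1 / 2)) *
      Real.exp (ε ^ 2 / 512 * minDistance (dualCode B)) ≤ 24 / ε ^ 2 := by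
  set C := dualCode B
  have hm' : (0 : ℝ) < m := by exact_mod_cast hm
  have hpε : ε ≤ p := by
    have : 0 ≤ (p - ε) * m := le_trans (Nat.cast_nonneg _) hℓ
    linarith [nonneg_of_mul_nonneg_left this hm']
  -- Half of the gap pays for the passage from the shell to rate $q$, half for sprinkling from $q$
  -- to $p$. The losses $\frac{\epsilon}{2}$, $\frac{\rho}{2}\ge\frac{\epsilon}{4}$ and $\frac13$
  -- give $24/\epsilon^2$; $\delta=\rho/4\ge\epsilon/8$ gives $\delta^2/8\ge\epsilon^2/512$.
  set q := p - ε / 2 with hq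
  set ρ := (p - q) / (1 - q) with hρ
  have hq1 : 0 < 1 - q := by linarith
  have hρε : ε / 2 ≤ ρ := by
    rw [hρ, le_div_iff₀ hq1]
    nlinarith
  have hρ1 : ρ ≤ 1 := by
    rw [hρ, div_le_one hq1]
    linarith
  have hpq : q + (1 - q) * ρ = p := by
    rw [hρ, mul_div_cancel₀ _ hq1.ne']
    ring
  have h1 := (isIncreasing_covered C (1 / 2)).shellProb_mul_le (q := q) (η := ε / 2)
    (by linarith) (by linarith) hm (by rw [hq]; convert hℓ using 2; ring)
  have h2 := mul_bernoulliProb_covered_le (q := q) (by linarith) (by linarith)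
    (by linarith : 0 ≤ ρ) hρ1 C
  rw [hpq] at h2
  have h3 := bernoulliProb_compl_mul_covered_le (by linarith : 0 ≤ p) (by linarith) C
    (by linarith : 0 ≤ ρ / 4)
  have h4 := bernoulliProb_covered_half_le (by linarith) hp B φ hφ
  have h5 := bernoulliProb_add_compl p (covered C (1 / 2))
  set s := shellProb ℓ (covered C (1 / 2))
  have hs : 0 ≤ s := shellProb_nonneg _ _
  set d : ℝ := (minDistance C : ℝ)
  have hd : 0 ≤ d := Nat.cast_nonneg _
  have h6 : ε ^ 2 / 8 * s ≤ bernoulliProb p (covered C (1 / 2 + ρ / 4)) := by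
    have h7 : ε / 4 * (ε / 2 * s) ≤ ρ / 2 * bernoulliProb q (covered C (1 / 2)) :=
      mul_le_mul (by linarith) h1 (by positivity) (by linarith)
    linarith
  have h8 : Real.exp (ε ^ 2 / 512 * d) ≤ Real.exp ((ρ / 4) ^ 2 * d / 8) := by
    apply Real.exp_le_exp.2
    have : (ε / 8) ^ 2 ≤ (ρ / 4) ^ 2 :=
      pow_le_pow_left₀ (by positivity) (by linarith) 2
    nlinarith
  have h9 : 1 / 3 * (ε ^ 2 / 8 * s * Real.exp (ε ^ 2 / 512 * d)) ≤ 1 := by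
    refine le_trans ?_ h3
    have : 1 / 3 ≤ bernoulliProb p (covered C (1 / 2))ᶜ := by linarith
    have := bernoulliProb_nonneg (by linarith : 0 ≤ p) (by linarith) (covered C (1 / 2 + ρ / 4))
    gcongr
  rw [le_div_iff₀ (by positivity)]
  linarith

/-- Geometric interpolation between $s\le1$ and $s\le Ke^{-ad}$, with the exponent $\tau$ chosen so
that $K^\tau=\sqrt2\le\sqrt m$. -/
theorem le_sqrt_mul_exp {s K a d : ℝ} {m : ℕ} (hm : 2 ≤ m) (hs1 : s ≤ 1) (hK : 2 ≤ K)
    (h : s * Real.exp (a * d) ≤ K) :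
    s ≤ Real.sqrt m * Real.exp (-(Real.log 2 / (2 * Real.log K) * a * d)) := by
  have h2 : 0 < Real.log 2 := Real.log_pos one_lt_two
  have hlog : Real.log 2 ≤ Real.log K := Real.log_le_log two_pos hK
  set τ := Real.log 2 / (2 * Real.log K) with hτ
  have hτ0 : 0 ≤ τ := div_nonneg h2.le (by linarith)
  have hτ1 : τ ≤ 1 := by
    rw [hτ, div_le_one (by linarith)]
    linarith
  have hτK : τ * Real.log K = Real.log 2 / 2 := by
    rw [hτ]
    field_simp [(h2.trans_le hlog).ne']
  have hsK : s ≤ Real.exp (Real.log K - a * d) := by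
    rw [Real.exp_sub, Real.exp_log (by linarith)]
    exact (le_div_iff₀ (Real.exp_pos _)).2 h
  have hmix : s ≤ Real.exp (τ * (Real.log K - a * d)) := by
    rcases le_total 0 (Real.log K - a * d) with h0 | h0
    · exact hs1.trans (Real.one_le_exp (mul_nonneg hτ0 h0))
    · exact hsK.trans (Real.exp_le_exp.2 (by nlinarith))
  have hsqrt : Real.exp (Real.log 2 / 2) ≤ Real.sqrt m := by
    rw [Real.exp_half, Real.exp_log two_pos]
    exact Real.sqrt_le_sqrt (by exact_mod_cast hm)
  calc s ≤ Real.exp (Real.log 2 / 2) * Real.exp (-(τ * a * d)) := by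
        rw [← Real.exp_add, ← hτK]
        convert hmix using 2
        ring
    _ ≤ _ := by gcongr

end BinaryCode

theorem lemmaD1 (ε p : ℝ) (hε : 0 < ε) (hp0 : 0 ≤ p) (hp : p ≤ 1 / 2) :
    ∃ c : ℝ, 0 < c ∧
      ∀ (m n : ℕ) (B : Matrix (Fin m) (Fin n) (ZMod 2))
        (φ : (Fin n → ZMod 2) → (Fin m → ZMod 2)) (ℓ : ℕ),
        2 / 3 ≤ BinaryCode.bernoulliProb p
            {y : Fin m → ZMod 2 | φ (Matrix.mulVec (Matrix.transpose B) y) = y} →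
        (ℓ : ℝ) ≤ (p - ε) * (m : ℝ) →
        BinaryCode.shellProb ℓ
            {y : Fin m → ZMod 2 |
              0 < {z : Fin m → ZMod 2 |
                    z ∈ BinaryCode.dualCode B ∧ z ≠ 0 ∧ hammingDist z y ≤ ℓ}.ncard}
          ≤ Real.sqrt (m : ℝ) *
              Real.exp (-(c * (BinaryCode.minDistance (BinaryCode.dualCode B) : ℝ))) := by
  -- The added 2 ensures $K\ge2$, hence $\tau\le1$ in the interpolation.
  set K : ℝ := 24 / ε ^ 2 + 2 with hK
  have hK2 : 2 ≤ K := le_add_of_nonneg_left (by positivity)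
  have hlogK : 0 < Real.log K := Real.log_pos (by linarith)
  have hlog2 : 0 < Real.log 2 := Real.log_pos one_lt_two
  refine ⟨Real.log 2 / (2 * Real.log K) * (ε ^ 2 / 512), by positivity, ?_⟩
  intro m n B φ ℓ hφ hℓ
  rw [BinaryCode.shellProb_confusable_eq]
  -- For $m\le1$ the factor $\sqrt m$ cannot absorb a constant, but then $\ell\le(p-\epsilon)m<1$
  -- and only $y=0$ remains, which no nonzero codeword half-covers.
  rcases le_or_gt m 1 with hm | hm
  · have hℓ0 : ℓ = 0 := by
      have hm' : (m : ℝ) ≤ 1 := by exact_mod_cast hm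
      have hm0 : (0 : ℝ) ≤ m := Nat.cast_nonneg m
      have : (ℓ : ℝ) < 1 := by nlinarith
      exact Nat.lt_one_iff.1 (by exact_mod_cast this)
    rw [hℓ0, BinaryCode.shellProb_zero_covered]
    positivity
  · refine BinaryCode.le_sqrt_mul_exp hm (BinaryCode.shellProb_le_one _ _) hK2 ?_
    exact (BinaryCode.shellProb_covered_le hε hp B φ hφ (by omega) hℓ).trans (by linarith)
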